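/- Let $\mathbb H_+=\{(x,y)\in\mathbb R^2: y\ge 0\}$. For a symmetric positive definite $2\times2$ matrix $\Sigma$, a vector $\mu\in\mathbb R^2$ and vectors $R_+,R_-\in\mathbb R^2$, a reflected Brownian motion (RBM) in $\mathbb H_+$ with parameters $(\Sigma,\mu,R_\pm)$ is a continuous adapted $\mathbb H_+$-valued process $Z$ on a probability space such that, for some filtration and some standard two-dimensional Brownian motion $W$ relative to it, almost surely $$Z_t=Z_0+\sqrt\Sigma\,W_t+\mu t+R_+\ell_+(t)+R_-\ell_-(t)\qquad(t\ge 0),$$ where $\ell_\pm$ are adapted, continuous, nondecreasing, start at $0$, and increase only at times when $Z\in\mathbb R_\pm\times\{0\}$, with $\mathbb R_+=[0,\infty)$ and $\mathbb R_-=(-\infty,0]$. A probability measure $\boldsymbol\pi$ is an invariant measure for these parameters if an RBM with initial law $\boldsymbol\pi$ exists and every RBM with initial law $\boldsymbol\pi$ has law $\boldsymbol\pi$ at all times. **Proposition.** Let $\Sigma=(\sigma_{ij})$ be a symmetric positive definite $2\times 2$ matrix. 1. There is a unique orientation-preserving linear map $T$ of $\mathbb R^2$ that maps $\mathbb H_+$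 onto itself and satisfies $T\Sigma T^\intercal=\mathrm I_2$. Explicitly, $$T=\frac1{\sqrt{\sigma_{22}\det\Sigma}}\begin{pmatrix}\sigma_{22}&-\sigma_{12}\\0&\sqrt{\det\Sigma}\end{pmatrix}.$$ Let $\mu\in\mathbb R^2$ and $R_\pm=(r_\pm,1)^\intercal$ with $r_\pm\in\mathbb R$. 2. If $Z$ is an RBM with parameters $(\Sigma,\mu,R_\pm)$, then $TZ$ is an RBM with parameters $(\mathrm I_2,T\mu,TR_\pm)$. Moreover, a process is an RBM with parameters $(\mathrm I_2,T\mu,TR_\pm)$ if and only if it is one with parameters $(\mathrm I_2,T\mu,\widetilde R_\pm)$, where $\widetilde R_\pm=\sqrt{\sigma_{22}}\,TR_\pm=\bigl(\tfrac{\sigma_{22}r_\pm-\sigma_{12}}{\sqrt{\det\Sigma}},1\bigr)^\intercal$. 3. The invariant measures for $(\mathrm I_2,T\mu,TR_\pm)$ are exactly the pushforwards $T_*\boldsymbol\pi$ of the invariant measures $\boldsymbol\pi$ for $(\Sigma,\mu,R_\pm)$. In particular, if $\boldsymbol\pi$ is the unique invariant measure for $(\Sigma,\mu,R_\pm)$,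 then $\widetilde{\boldsymbol\pi}=T_*\boldsymbol\pi$ is the unique invariant measure for $(\mathrm I_2,T\mu,TR_\pm)$. 4. Let $\boldsymbol\pi$ be an invariant measure for $(\Sigma,\mu,R_\pm)$ and $\widetilde{\boldsymbol\pi}=T_*\boldsymbol\pi$. Then $\boldsymbol\pi$ has a density with respect to Lebesgue measure on $\mathbb H_+$ if and only if $\widetilde{\boldsymbol\pi}$ has one. If $\widetilde\pi$ is a density of $\widetilde{\boldsymbol\pi}$, then $$(u,v)\mapsto\frac1{\sqrt{\det\Sigma}}\,\widetilde\pi\!\left(\frac{\sigma_{22}u-\sigma_{12}v}{\sqrt{\sigma_{22}\det\Sigma}},\frac v{\sqrt{\sigma_{22}}}\right)$$ is a density of $\boldsymbol\pi$. Any densities $\pi$ and $\widetilde\pi$ of $\boldsymbol\pi$ and $\widetilde{\boldsymbol\pi}$ satisfy $$\pi(u,v)=\frac1{\sqrt{\det\Sigma}}\,\widetilde\pi\!\left(\frac{\sigma_{22}u-\sigma_{12}v}{\sqrt{\sigma_{22}\det\Sigma}},\frac v{\sqrt{\sigma_{22}}}\right)$$ for almost every $(u,v)\in\mathbb H_+$,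 and at every $(u,v)\in\mathbb H_+$ such that $\pi$, as a function on $\mathbb H_+$, is continuous at $(u,v)$ and $\widetilde\pi$, as a function on $\mathbb H_+$, is continuous at $T(u,v)$. -/

import Mathlib

open MeasureTheory ProbabilityTheory Matrix
open scoped NNReal ENNReal

noncomputable section

/-- The closed upper half-plane `ℝ × ℝ₊`. -/
def closedHalfPlane : Set (Fin 2 → ℝ) := {x | 0 ≤ x 1}

/-- The boundary half-line `ℝ₊ × {0}`. -/
def rightAxis : Set (Fin 2 → ℝ) := {x | 0 ≤ x 0 ∧ x 1 = 0}

/-- The boundary half-line `ℝ₋ × {0}`. -/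
def leftAxis : Set (Fin 2 → ℝ) := {x | x 0 ≤ 0 ∧ x 1 = 0}

/-- `W` is a standard two-dimensional Brownian motion, started at `0`, relative to the
filtration `𝓕` on the probability space `(Ω, P)`. -/
structure IsStandardBM {Ω : Type*} [mΩ : MeasurableSpace Ω] (P : Measure Ω)
    (𝓕 : Filtration ℝ≥0 mΩ) (W : ℝ≥0 → Ω → Fin 2 → ℝ) : Prop where
  adapted : ∀ t, Measurable[𝓕 t] (W t)
  zero : ∀ᵐ ω ∂P, W 0 ω = 0
  continuous : ∀ᵐ ω ∂P, Continuous fun t => W t ω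
  indep : ∀ s t, s ≤ t →
    Indep (MeasurableSpace.comap (fun ω => W t ω - W s ω) inferInstance) (𝓕 s) P
  law : ∀ s t, s ≤ t →
    HasLaw (fun ω => W t ω - W s ω) (Measure.pi fun _ : Fin 2 => gaussianReal 0 (t - s)) P

/-- `l` is the boundary (pushing, or local time) process of `Z` on the closed set `F`: it is
adapted, and almost surely it starts at `0`, is continuous and nondecreasing, and increases only
at times when `Z` is in `F` (it is constant on every time interval during which `Z` avoids `F`;
as `Z` is continuous and `F` is closed, this says that the measure `dl` does not charge
`{t | Z t ∉ F}`). -/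
structure IsBoundaryLocalTime {Ω : Type*} [mΩ : MeasurableSpace Ω] (P : Measure Ω)
    (𝓕 : Filtration ℝ≥0 mΩ) (Z : ℝ≥0 → Ω → Fin 2 → ℝ) (F : Set (Fin 2 → ℝ))
    (l : ℝ≥0 → Ω → ℝ) : Prop where
  adapted : ∀ t, Measurable[𝓕 t] (l t)
  zero : ∀ᵐ ω ∂P, l 0 ω = 0
  continuous : ∀ᵐ ω ∂P, Continuous fun t => l t ω
  monotone : ∀ᵐ ω ∂P, Monotone fun t => l t ω
  increases_only_on : ∀ᵐ ω ∂P, ∀ s t : ℝ≥0, s ≤ t →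
    (∀ u ∈ Set.Icc s t, Z u ω ∉ F) → l s ω = l t ω

open scoped MatrixOrder in
/-- `Z` is a (semimartingale) reflected Brownian motion in the closed upper half-plane with
covariance matrix `S`, drift `μ`, and reflection vectors `Rp` on `ℝ₊ × {0}` and `Rm` on
`ℝ₋ × {0}`: for some filtration, some Brownian motion `W` and some boundary local times `lp`, `lm`,
`Z t = Z 0 + √S W t + t μ + lp t Rp + lm t Rm`.
Here `CFC.sqrt S` is the positive semidefinite square root of `S`. -/
def IsRBM {Ω : Type*} [mΩ : MeasurableSpace Ω] (P : Measure Ω)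
    (S : Matrix (Fin 2) (Fin 2) ℝ) (μ Rp Rm : Fin 2 → ℝ) (Z : ℝ≥0 → Ω → Fin 2 → ℝ) : Prop :=
  ∃ (𝓕 : Filtration ℝ≥0 mΩ) (W : ℝ≥0 → Ω → Fin 2 → ℝ) (lp lm : ℝ≥0 → Ω → ℝ),
    IsStandardBM P 𝓕 W ∧
    (∀ t, Measurable[𝓕 t] (Z t)) ∧
    (∀ᵐ ω ∂P, Continuous fun t => Z t ω) ∧
    (∀ᵐ ω ∂P, ∀ t, Z t ω ∈ closedHalfPlane) ∧
    IsBoundaryLocalTime P 𝓕 Z rightAxis lp ∧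
    IsBoundaryLocalTime P 𝓕 Z leftAxis lm ∧
    ∀ᵐ ω ∂P, ∀ t : ℝ≥0,
      Z t ω = Z 0 ω + CFC.sqrt S *ᵥ W t ω + (t : ℝ) • μ + lp t ω • Rp + lm t ω • Rm

/-- `ν` is an invariant (stationary) probability measure of the reflected Brownian motion with
parameters `(S, μ, Rp, Rm)`: the process can be started with initial law `ν`, and whenever it is,
it has law `ν` at all times. -/
def IsInvariantMeasure (S : Matrix (Fin 2) (Fin 2) ℝ) (μ Rp Rm : Fin 2 → ℝ)
    (ν : Measure (Fin 2 → ℝ)) : Prop :=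
  IsProbabilityMeasure ν ∧
  (∃ (Ω : Type) (_ : MeasurableSpace Ω) (P : Measure Ω) (Z : ℝ≥0 → Ω → Fin 2 → ℝ),
    IsProbabilityMeasure P ∧ IsRBM P S μ Rp Rm Z ∧ P.map (Z 0) = ν) ∧
  ∀ (Ω : Type) (_ : MeasurableSpace Ω) (P : Measure Ω) (Z : ℝ≥0 → Ω → Fin 2 → ℝ),
    IsProbabilityMeasure P → IsRBM P S μ Rp Rm Z → P.map (Z 0) = ν → ∀ t, P.map (Z t) = ν

/-- `p` is a density of `ν` with respect to Lebesgue measure on the closed upper half-plane. -/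
structure IsHalfPlaneDensity (ν : Measure (Fin 2 → ℝ)) (p : (Fin 2 → ℝ) → ℝ) : Prop where
  aemeasurable : AEMeasurable p (volume.restrict closedHalfPlane)
  nonneg : ∀ᵐ x ∂(volume.restrict closedHalfPlane), 0 ≤ p x
  eq : ν = (volume.restrict closedHalfPlane).withDensity fun x => ENNReal.ofReal (p x)

/-- `T` is an orientation-preserving linear map of the plane that maps the closed upper half-plane
onto itself and satisfies `T S Tᵀ = I`. -/
structure IsHalfPlaneWhitening (S T : Matrix (Fin 2) (Fin 2) ℝ) : Prop where
  orientation : 0 < T.det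
  image_eq : (fun x => T *ᵥ x) '' closedHalfPlane = closedHalfPlane
  whitens : T * S * Tᵀ = 1

end

/-! An orientation-preserving linear map `A` of the half-plane onto itself is upper triangular with
positive diagonal. Hence it preserves and reflects membership in the half-plane and in each boundary
half-axis, so the local times of `Z` also serve for `A Z`, with reflection vectors `A R`. The
Brownian term satisfies `A √S W = √S' (O W)` with `O` orthogonal (`exists_orthogonal_mul_sqrt`), and
`O W` is again a Brownian motion by rotational invariance of Gaussian laws. This gives
`IsRBM.mulVec`.

These matrices are closed under inversion, so every transfer result also runs backwards. Invariant
measures therefore correspond bijectively, and densities transform with the constant Jacobian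
`A.det`, which is `1 / √S.det` for the whitening map.

For triangular `T` with positive diagonal, `T S Tᵀ = 1` can be solved entry by entry, as in a
Cholesky factorisation, which gives uniqueness and the formula. -/

/-- An upper triangular `2 × 2` matrix with positive diagonal. These are the orientation-preserving
linear maps of the plane which map the upper half-plane onto itself. -/
structure IsPositiveTriangular (A : Matrix (Fin 2) (Fin 2) ℝ) : Prop where
  lower : A 1 0 = 0
  left_pos : 0 < A 0 0
  right_pos : 0 < A 1 1

namespace IsPositiveTriangular

variable {A : Matrix (Fin 2) (Fin 2) ℝ}

lemma det_eq (hA : IsPositiveTriangular A) : A.det = A 0 0 * A 1 1 := by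
  rw [det_fin_two, hA.lower, mul_zero, sub_zero]

lemma det_pos (hA : IsPositiveTriangular A) : 0 < A.det := by
  rw [hA.det_eq]
  exact mul_pos hA.left_pos hA.right_pos

lemma isUnit_det (hA : IsPositiveTriangular A) : IsUnit A.det :=
  hA.det_pos.ne'.isUnit

lemma inv (hA : IsPositiveTriangular A) : IsPositiveTriangular A⁻¹ := by
  have hd := inv_pos.2 hA.det_pos
  have h0 := hA.left_pos
  have h1 := hA.right_pos
  constructor <;> rw [inv_def, Ring.inverse_eq_inv', adjugate_fin_two]
  · simp [hA.lower]
  · simpa using mul_pos hd h1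
  · simpa using mul_pos hd h0

lemma mulVec_one (hA : IsPositiveTriangular A) (x : Fin 2 → ℝ) : (A *ᵥ x) 1 = A 1 1 * x 1 := by
  simp [mulVec, dotProduct, Fin.sum_univ_two, hA.lower]

lemma mulVec_zero (A : Matrix (Fin 2) (Fin 2) ℝ) (x : Fin 2 → ℝ) :
    (A *ᵥ x) 0 = A 0 0 * x 0 + A 0 1 * x 1 := by
  simp [mulVec, dotProduct, Fin.sum_univ_two]

lemma mulVec_mem_closedHalfPlane (hA : IsPositiveTriangular A) (x : Fin 2 → ℝ) :
    A *ᵥ x ∈ closedHalfPlane ↔ x ∈ closedHalfPlane := by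
  simp only [closedHalfPlane, Set.mem_ofPred_eq, hA.mulVec_one, mul_nonneg_iff_of_pos_left,
    hA.right_pos]

lemma mulVec_mem_rightAxis (hA : IsPositiveTriangular A) (x : Fin 2 → ℝ) :
    A *ᵥ x ∈ rightAxis ↔ x ∈ rightAxis := by
  simp only [rightAxis, Set.mem_ofPred_eq, hA.mulVec_one, mulVec_zero, mul_eq_zero,
    hA.right_pos.ne', false_or]
  refine and_congr_left fun h => ?_
  rw [h, mul_zero, add_zero, mul_nonneg_iff_of_pos_left hA.left_pos]

lemma mulVec_mem_leftAxis (hA : IsPositiveTriangular A) (x : Fin 2 → ℝ) :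
    A *ᵥ x ∈ leftAxis ↔ x ∈ leftAxis := by
  simp only [leftAxis, Set.mem_ofPred_eq, hA.mulVec_one, mulVec_zero, mul_eq_zero,
    hA.right_pos.ne', false_or]
  refine and_congr_left fun h => ?_
  rw [h, mul_zero, add_zero, ← neg_nonneg, ← mul_neg, mul_nonneg_iff_of_pos_left hA.left_pos,
    neg_nonneg]

lemma inv_mulVec_mulVec (hA : IsPositiveTriangular A) (x : Fin 2 → ℝ) : A⁻¹ *ᵥ A *ᵥ x = x := by
  rw [mulVec_mulVec, nonsing_inv_mul _ hA.isUnit_det, one_mulVec]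

lemma mulVec_inv_mulVec (hA : IsPositiveTriangular A) (x : Fin 2 → ℝ) : A *ᵥ A⁻¹ *ᵥ x = x := by
  rw [mulVec_mulVec, mul_nonsing_inv _ hA.isUnit_det, one_mulVec]

lemma image_closedHalfPlane (hA : IsPositiveTriangular A) :
    (fun x => A *ᵥ x) '' closedHalfPlane = closedHalfPlane := by
  ext y
  constructor
  · rintro ⟨x, hx, rfl⟩
    exact (hA.mulVec_mem_closedHalfPlane x).2 hx
  · exact fun hy => ⟨A⁻¹ *ᵥ y, (hA.inv.mulVec_mem_closedHalfPlane y).2 hy, hA.mulVec_inv_mulVec y⟩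

end IsPositiveTriangular

lemma measurable_matrix_mulVec {m n : Type*} [Fintype m] [Fintype n] (A : Matrix m n ℝ) :
    Measurable fun x : n → ℝ => A *ᵥ x :=
  (Continuous.matrix_mulVec continuous_const continuous_id).measurable

lemma IsPositiveTriangular.measurableEmbedding {A : Matrix (Fin 2) (Fin 2) ℝ}
    (hA : IsPositiveTriangular A) : MeasurableEmbedding fun x : Fin 2 → ℝ => A *ᵥ x :=
  MeasurableEquiv.measurableEmbedding
    { toFun := fun x => A *ᵥ x
      invFun := fun x => A⁻¹ *ᵥ x
      left_inv := hA.inv_mulVec_mulVec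
      right_inv := hA.mulVec_inv_mulVec
      measurable_toFun := measurable_matrix_mulVec A
      measurable_invFun := measurable_matrix_mulVec A⁻¹ }

/-! ### Rotational invariance of Gaussian measures -/

/-- Centred isotropic Gaussian measures are invariant under orthogonal matrices. -/
lemma map_mulVec_pi_gaussianReal {ι : Type*} [Fintype ι] [DecidableEq ι] {O : Matrix ι ι ℝ}
    (hO : O * Oᵀ = 1) (v : ℝ≥0) :
    (Measure.pi fun _ : ι => gaussianReal 0 v).map (fun x => O *ᵥ x) =
      Measure.pi fun _ : ι => gaussianReal 0 v := by
  have hm := measurable_matrix_mulVec O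
  have := Measure.isProbabilityMeasure_map
    (μ := Measure.pi fun _ : ι => gaussianReal 0 v) hm.aemeasurable
  -- The characteristic function depends on `t` only through its squared norm, which `Oᵀ` preserves.
  have key (t : EuclideanSpace ℝ ι) :
      ∏ i, charFun (gaussianReal 0 v) (t i) =
        Complex.exp (-(v : ℝ) * ((t.ofLp ⬝ᵥ t.ofLp : ℝ) : ℂ) / 2) := by
    simp_rw [charFun_gaussianReal, ← Complex.exp_sum]
    congr 1
    simp only [dotProduct, Complex.ofReal_sum, Complex.ofReal_mul, Complex.ofReal_zero, mul_zero,
      zero_mul, zero_sub, Finset.mul_sum, Finset.sum_div]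
    refine Finset.sum_congr rfl fun i _ => ?_
    ring
  refine charFun_eq_pi_iff.1 fun t => ?_
  have h1 := charFun_pi (μ := fun _ : ι => gaussianReal 0 v)
    (WithLp.toLp 2 (Oᵀ *ᵥ t.ofLp) : EuclideanSpace ℝ ι)
  rw [key] at h1 ⊢
  have h2 : (Oᵀ *ᵥ t.ofLp) ⬝ᵥ (Oᵀ *ᵥ t.ofLp) = t.ofLp ⬝ᵥ t.ofLp := by
    rw [dotProduct_mulVec, vecMul_transpose, mulVec_mulVec, hO, one_mulVec]
  rw [h2] at h1
  rw [← h1, charFun_apply, charFun_apply, Measure.map_map (by fun_prop) hm,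
    integral_map (by fun_prop) (by fun_prop), integral_map (by fun_prop) (by fun_prop)]
  congr 1
  ext x
  have h3 : inner ℝ (WithLp.toLp 2 (O *ᵥ x) : EuclideanSpace ℝ ι) t =
      inner ℝ (WithLp.toLp 2 x : EuclideanSpace ℝ ι) (WithLp.toLp 2 (Oᵀ *ᵥ t.ofLp)) := by
    simp only [EuclideanSpace.inner_eq_star_dotProduct, star_trivial]
    rw [dotProduct_mulVec, ← mulVec_transpose, dotProduct_comm]
  simp only [Function.comp_apply, h3]

/-! ### Linear images and rescalings of reflected Brownian motions -/

section RBM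

variable {Ω : Type*} [mΩ : MeasurableSpace Ω] {P : Measure Ω} {𝓕 : Filtration ℝ≥0 mΩ}

lemma IsStandardBM.mulVec {W : ℝ≥0 → Ω → Fin 2 → ℝ} (hW : IsStandardBM P 𝓕 W)
    {O : Matrix (Fin 2) (Fin 2) ℝ} (hO : O * Oᵀ = 1) :
    IsStandardBM P 𝓕 fun t ω => O *ᵥ W t ω where
  adapted t := (measurable_matrix_mulVec O).comp (hW.adapted t)
  zero := hW.zero.mono fun ω h => by simp [h]
  continuous := hW.continuous.mono fun ω h => Continuous.matrix_mulVec continuous_const h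
  indep s t hst := by
    refine indep_of_indep_of_le_left (hW.indep s t hst) ?_
    simp only [← mulVec_sub]
    exact ((measurable_matrix_mulVec O).comp (comap_measurable _)).comap_le
  law s t hst := by
    have h : HasLaw (fun x : Fin 2 → ℝ => O *ᵥ x)
        (Measure.pi fun _ : Fin 2 => gaussianReal 0 (t - s))
        (Measure.pi fun _ : Fin 2 => gaussianReal 0 (t - s)) :=
      ⟨(measurable_matrix_mulVec O).aemeasurable, map_mulVec_pi_gaussianReal hO _⟩
    simpa only [← mulVec_sub, Function.comp_def] using h.comp (hW.law s t hst)

lemma IsBoundaryLocalTime.of_forall_mem_iff {Z Z' : ℝ≥0 → Ω → Fin 2 → ℝ} {F : Set (Fin 2 → ℝ)}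
    {l : ℝ≥0 → Ω → ℝ} (hl : IsBoundaryLocalTime P 𝓕 Z F l)
    (h : ∀ t ω, Z' t ω ∈ F ↔ Z t ω ∈ F) : IsBoundaryLocalTime P 𝓕 Z' F l where
  adapted := hl.adapted
  zero := hl.zero
  continuous := hl.continuous
  monotone := hl.monotone
  increases_only_on := by simpa only [h] using hl.increases_only_on

lemma IsBoundaryLocalTime.const_mul {Z : ℝ≥0 → Ω → Fin 2 → ℝ} {F : Set (Fin 2 → ℝ)}
    {l : ℝ≥0 → Ω → ℝ} (hl : IsBoundaryLocalTime P 𝓕 Z F l) {c : ℝ} (hc : 0 ≤ c) :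
    IsBoundaryLocalTime P 𝓕 Z F fun t ω => c * l t ω where
  adapted t := (hl.adapted t).const_mul c
  zero := hl.zero.mono fun ω h => by simp [h]
  continuous := hl.continuous.mono fun ω h => continuous_const.mul h
  monotone := hl.monotone.mono fun ω h => h.const_mul hc
  increases_only_on := hl.increases_only_on.mono fun ω h s t hst hu => by
    rw [h s t hst hu]

/-- Positive rescaling of the reflection vectors does not change the reflected Brownian motion. -/
lemma IsRBM.smul_reflection {S : Matrix (Fin 2) (Fin 2) ℝ} {μ Rp Rm : Fin 2 → ℝ}
    {Z : ℝ≥0 → Ω → Fin 2 → ℝ} (hZ : IsRBM P S μ Rp Rm Z) {c : ℝ} (hc : 0 < c) :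
    IsRBM P S μ (c • Rp) (c • Rm) Z := by
  obtain ⟨𝓕, W, lp, lm, hW, had, hcont, hmem, hlp, hlm, heq⟩ := hZ
  -- The local times absorb the factor: `(c⁻¹ l) (c R) = l R`.
  refine ⟨𝓕, W, fun t ω => c⁻¹ * lp t ω, fun t ω => c⁻¹ * lm t ω, hW, had, hcont, hmem,
    hlp.const_mul (inv_nonneg.2 hc.le), hlm.const_mul (inv_nonneg.2 hc.le), ?_⟩
  filter_upwards [heq] with ω h t
  rw [h t, smul_smul, smul_smul, mul_right_comm, inv_mul_cancel₀ hc.ne', one_mul,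
    mul_right_comm, inv_mul_cancel₀ hc.ne', one_mul]

lemma isRBM_smul_reflection_iff {S : Matrix (Fin 2) (Fin 2) ℝ} {μ Rp Rm : Fin 2 → ℝ}
    {Z : ℝ≥0 → Ω → Fin 2 → ℝ} {c : ℝ} (hc : 0 < c) :
    IsRBM P S μ Rp Rm Z ↔ IsRBM P S μ (c • Rp) (c • Rm) Z := by
  refine ⟨fun h => h.smul_reflection hc, fun h => ?_⟩
  simpa only [smul_smul, inv_mul_cancel₀ hc.ne', one_smul] using
    h.smul_reflection (inv_pos.2 hc)

open scoped MatrixOrder in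
/-- The square roots of congruent covariance matrices differ by an orthogonal matrix. -/
lemma exists_orthogonal_mul_sqrt {n : Type*} [Fintype n] [DecidableEq n] {S S' A : Matrix n n ℝ}
    (hS : S.PosDef) (hS' : S'.PosDef) (h : A * S * Aᵀ = S') :
    ∃ O : Matrix n n ℝ, O * Oᵀ = 1 ∧ CFC.sqrt S' * O = A * CFC.sqrt S := by
  have hq : CFC.sqrt S * CFC.sqrt S = S := CFC.sqrt_mul_sqrt_self S hS.posSemidef.nonneg
  have hq' : CFC.sqrt S' * CFC.sqrt S' = S' := CFC.sqrt_mul_sqrt_self S' hS'.posSemidef.nonneg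
  have ht : (CFC.sqrt S)ᵀ = CFC.sqrt S := (CFC.sqrt_nonneg S).posSemidef.isHermitian
  have ht' : (CFC.sqrt S')ᵀ = CFC.sqrt S' := (CFC.sqrt_nonneg S').posSemidef.isHermitian
  have hu : IsUnit (CFC.sqrt S').det := by
    have : IsUnit (CFC.sqrt S' * CFC.sqrt S').det := by
      rw [hq']
      exact hS'.det_pos.ne'.isUnit
    rw [det_mul] at this
    exact isUnit_of_mul_isUnit_left this
  -- The required identity forces this choice of `O`; orthogonality is then `A S Aᵀ = S'` conjugated
  -- by the inverse root of `S'`.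
  refine ⟨(CFC.sqrt S')⁻¹ * (A * CFC.sqrt S), ?_, mul_nonsing_inv_cancel_left _ _ hu⟩
  rw [transpose_mul, transpose_mul, transpose_nonsing_inv, ht, ht']
  calc (CFC.sqrt S')⁻¹ * (A * CFC.sqrt S) * (CFC.sqrt S * Aᵀ * (CFC.sqrt S')⁻¹)
      = (CFC.sqrt S')⁻¹ * (A * (CFC.sqrt S * CFC.sqrt S) * Aᵀ) * (CFC.sqrt S')⁻¹ := by
        simp only [Matrix.mul_assoc]
    _ = 1 := by
        rw [hq, h]
        nth_rewrite 2 [← hq']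
        rw [nonsing_inv_mul_cancel_left _ _ hu, mul_nonsing_inv _ hu]

/-- The image of a reflected Brownian motion under a linear map of the half-plane. -/
lemma IsRBM.mulVec {S S' A : Matrix (Fin 2) (Fin 2) ℝ} (hA : IsPositiveTriangular A)
    (hS : S.PosDef) (hS' : S'.PosDef) (h : A * S * Aᵀ = S') {μ Rp Rm : Fin 2 → ℝ}
    {Z : ℝ≥0 → Ω → Fin 2 → ℝ} (hZ : IsRBM P S μ Rp Rm Z) :
    IsRBM P S' (A *ᵥ μ) (A *ᵥ Rp) (A *ᵥ Rm) fun t ω => A *ᵥ Z t ω := by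
  obtain ⟨𝓕, W, lp, lm, hW, had, hcont, hmem, hlp, hlm, heq⟩ := hZ
  obtain ⟨O, hO, hOA⟩ := exists_orthogonal_mul_sqrt hS hS' h
  refine ⟨𝓕, fun t ω => O *ᵥ W t ω, lp, lm, hW.mulVec hO,
    fun t => (measurable_matrix_mulVec A).comp (had t),
    hcont.mono fun ω h => Continuous.matrix_mulVec continuous_const h,
    hmem.mono fun ω h t => (hA.mulVec_mem_closedHalfPlane _).2 (h t),
    hlp.of_forall_mem_iff fun t ω => hA.mulVec_mem_rightAxis _,
    hlm.of_forall_mem_iff fun t ω => hA.mulVec_mem_leftAxis _, ?_⟩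
  filter_upwards [heq] with ω h t
  rw [h t]
  simp only [mulVec_add, mulVec_smul, mulVec_mulVec, hOA]

lemma IsRBM.measurable {S : Matrix (Fin 2) (Fin 2) ℝ} {μ Rp Rm : Fin 2 → ℝ}
    {Z : ℝ≥0 → Ω → Fin 2 → ℝ} (hZ : IsRBM P S μ Rp Rm Z) (t : ℝ≥0) : Measurable (Z t) := by
  obtain ⟨𝓕, W, lp, lm, -, had, -⟩ := hZ
  exact (had t).mono (𝓕.le t) le_rfl

end RBM

/-! ### Invariant measures -/

lemma mul_congr_inv {n : Type*} [Fintype n] [DecidableEq n] {S S' A : Matrix n n ℝ}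
    (hA : IsUnit A.det) (h : A * S * Aᵀ = S') : A⁻¹ * S' * A⁻¹ᵀ = S := by
  have hA' : IsUnit Aᵀ.det := by rwa [det_transpose]
  rw [← h, transpose_nonsing_inv, Matrix.mul_assoc A, nonsing_inv_mul_cancel_left _ _ hA,
    mul_nonsing_inv_cancel_right _ _ hA']

/-- The image of an invariant measure under a linear map of the half-plane. -/
lemma IsInvariantMeasure.map_mulVec {S S' A : Matrix (Fin 2) (Fin 2) ℝ}
    (hA : IsPositiveTriangular A) (hS : S.PosDef) (hS' : S'.PosDef) (h : A * S * Aᵀ = S')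
    {μ Rp Rm : Fin 2 → ℝ} {ν : Measure (Fin 2 → ℝ)} (hν : IsInvariantMeasure S μ Rp Rm ν) :
    IsInvariantMeasure S' (A *ᵥ μ) (A *ᵥ Rp) (A *ᵥ Rm) (ν.map fun x => A *ᵥ x) := by
  obtain ⟨hprob, ⟨Ω, mΩ, P, Z, hP, hZ, hZ0⟩, hinv⟩ := hν
  have hmA := measurable_matrix_mulVec A
  have hmA' := measurable_matrix_mulVec A⁻¹
  refine ⟨Measure.isProbabilityMeasure_map hmA.aemeasurable,
    ⟨Ω, mΩ, P, _, hP, hZ.mulVec hA hS hS' h, ?_⟩, ?_⟩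
  · rw [← hZ0, Measure.map_map hmA (hZ.measurable 0)]
    rfl
  · intro Ω mΩ P Z hP hZ hZ0 t
    -- An arbitrary process for the new parameters is pulled back by `A⁻¹`, where invariance of `ν`
    -- applies.
    have hY := hZ.mulVec hA.inv hS' hS (mul_congr_inv hA.isUnit_det h)
    simp only [hA.inv_mulVec_mulVec] at hY
    have hlaw (s : ℝ≥0) : P.map (fun ω => A⁻¹ *ᵥ Z s ω) = (P.map (Z s)).map fun x => A⁻¹ *ᵥ x :=
      (Measure.map_map hmA' (hZ.measurable s)).symm
    have ht := hinv Ω mΩ P _ hP hY (by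
      rw [hlaw, hZ0, Measure.map_map hmA' hmA]
      simp only [Function.comp_def, hA.inv_mulVec_mulVec, Measure.map_id']) t
    rw [← ht, hlaw, Measure.map_map hmA hmA']
    simp only [Function.comp_def, hA.mulVec_inv_mulVec, Measure.map_id']

/-! ### Densities on the half-plane -/

lemma measurableSet_closedHalfPlane : MeasurableSet closedHalfPlane :=
  measurableSet_le measurable_const (measurable_pi_apply 1)

lemma IsPositiveTriangular.map_volume_restrict {A : Matrix (Fin 2) (Fin 2) ℝ}
    (hA : IsPositiveTriangular A) :
    ENNReal.ofReal A.det • (volume.restrict closedHalfPlane).map (fun x => A *ᵥ x) =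
      volume.restrict closedHalfPlane := by
  have hpre : (fun x => A *ᵥ x) ⁻¹' closedHalfPlane = closedHalfPlane :=
    Set.ext hA.mulVec_mem_closedHalfPlane
  have h := Real.map_matrix_volume_pi_eq_smul_volume_pi hA.det_pos.ne'
  have h' : (volume : Measure (Fin 2 → ℝ)).map (fun x => A *ᵥ x) =
      ENNReal.ofReal |A.det⁻¹| • volume := h
  conv_lhs => rw [← hpre]
  rw [← Measure.restrict_map (measurable_matrix_mulVec A) measurableSet_closedHalfPlane, h',
    Measure.restrict_smul, smul_smul, ← ENNReal.ofReal_mul hA.det_pos.le,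
    abs_of_pos (inv_pos.2 hA.det_pos), mul_inv_cancel₀ hA.det_pos.ne', ENNReal.ofReal_one, one_smul]

/-- Allows almost-everywhere properties of a density to be pulled back along `A`. -/
lemma IsPositiveTriangular.quasiMeasurePreserving {A : Matrix (Fin 2) (Fin 2) ℝ}
    (hA : IsPositiveTriangular A) :
    Measure.QuasiMeasurePreserving (fun x => A *ᵥ x) (volume.restrict closedHalfPlane)
      (volume.restrict closedHalfPlane) := by
  refine ⟨measurable_matrix_mulVec A, ?_⟩
  conv_rhs => rw [← hA.map_volume_restrict]
  exact Measure.absolutelyContinuous_smul (ENNReal.ofReal_pos.2 hA.det_pos).ne'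

/-- Change of variables for half-plane densities under a linear map of the half-plane. -/
lemma IsHalfPlaneDensity.comp_mulVec {A : Matrix (Fin 2) (Fin 2) ℝ}
    (hA : IsPositiveTriangular A) {ν : Measure (Fin 2 → ℝ)} {p : (Fin 2 → ℝ) → ℝ}
    (hp : IsHalfPlaneDensity (ν.map fun x => A *ᵥ x) p) :
    IsHalfPlaneDensity ν fun x => A.det * p (A *ᵥ x) where
  aemeasurable := (hp.aemeasurable.comp_quasiMeasurePreserving hA.quasiMeasurePreserving).const_mul _
  nonneg := (hA.quasiMeasurePreserving.ae hp.nonneg).mono fun x hx =>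
    mul_nonneg hA.det_pos.le hx
  eq := by
    have hemb := hA.measurableEmbedding
    ext s hs
    have himg : MeasurableSet ((fun x => A *ᵥ x) '' s) := hemb.measurableSet_image.2 hs
    have h1 : ν s = (ν.map fun x => A *ᵥ x) ((fun x => A *ᵥ x) '' s) := by
      rw [hemb.map_apply, Set.preimage_image_eq _ hemb.injective]
    rw [h1, hp.eq, withDensity_apply _ himg, withDensity_apply _ hs]
    -- The Jacobian enters here: restricted Lebesgue measure is `A.det` times its own image under
    -- `A`.
    conv_lhs => rw [← hA.map_volume_restrict]
    rw [Measure.restrict_smul, lintegral_smul_measure, hemb.restrict_map, hemb.lintegral_map,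
      Set.preimage_image_eq _ hemb.injective, smul_eq_mul,
      ← lintegral_const_mul' _ _ ENNReal.ofReal_ne_top]
    simp only [ENNReal.ofReal_mul hA.det_pos.le]

lemma IsHalfPlaneDensity.ae_eq {ν : Measure (Fin 2 → ℝ)} [IsFiniteMeasure ν]
    {p q : (Fin 2 → ℝ) → ℝ} (hp : IsHalfPlaneDensity ν p) (hq : IsHalfPlaneDensity ν q) :
    p =ᵐ[volume.restrict closedHalfPlane] q := by
  have h := (withDensity_eq_iff_of_sigmaFinite hp.aemeasurable.ennreal_ofReal
    hq.aemeasurable.ennreal_ofReal).1 (hp.eq.symm.trans hq.eq)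
  filter_upwards [h, hp.nonneg, hq.nonneg] with x hx h1 h2
  exact (ENNReal.ofReal_eq_ofReal_iff h1 h2).1 hx

/-- Every relative neighbourhood of a point of the half-plane has positive Lebesgue measure. -/
lemma volume_restrict_closedHalfPlane_nhdsWithin_pos {x : Fin 2 → ℝ} (hx : x ∈ closedHalfPlane)
    {s : Set (Fin 2 → ℝ)} (hs : s ∈ nhdsWithin x closedHalfPlane) :
    volume.restrict closedHalfPlane s ≠ 0 := by
  obtain ⟨u, hu, hxu, hus⟩ := mem_nhdsWithin.1 hs
  have hVopen : IsOpen (u ∩ {y : Fin 2 → ℝ | 0 < y 1}) :=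
    hu.inter (isOpen_lt continuous_const (continuous_apply 1))
  -- The point `x` may lie on the boundary; a small upward shift stays in `u` and enters the open
  -- half-plane.
  have hVne : (u ∩ {y : Fin 2 → ℝ | 0 < y 1}).Nonempty := by
    have hcont : Continuous fun ε : ℝ => x + ε • (Pi.single 1 1 : Fin 2 → ℝ) := by fun_prop
    have hev : ∀ᶠ ε in nhdsWithin (0 : ℝ) (Set.Ioi 0),
        x + ε • (Pi.single 1 1 : Fin 2 → ℝ) ∈ u :=
      (hcont.tendsto' 0 x (by simp)).mono_left nhdsWithin_le_nhds (hu.mem_nhds hxu)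
    obtain ⟨ε, hε, hpos⟩ := (hev.and self_mem_nhdsWithin).exists
    refine ⟨_, hε, ?_⟩
    have h0 : 0 ≤ x 1 := hx
    have h1 : 0 < ε := hpos
    simpa using add_pos_of_nonneg_of_pos h0 h1
  have hVsub : u ∩ {y : Fin 2 → ℝ | 0 < y 1} ⊆ s ∩ closedHalfPlane := fun y hy =>
    have hy' : y ∈ closedHalfPlane := le_of_lt (show 0 < y 1 from hy.2)
    ⟨hus ⟨hy.1, hy'⟩, hy'⟩
  rw [Measure.restrict_apply' measurableSet_closedHalfPlane]
  exact ((hVopen.measure_pos volume hVne).trans_le (measure_mono hVsub)).ne'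

/-- If the values differed at `x`, continuity would make them differ on a relative neighbourhood,
which has positive measure. -/
lemma eq_of_ae_eq_of_continuousWithinAt {p q : (Fin 2 → ℝ) → ℝ}
    (h : p =ᵐ[volume.restrict closedHalfPlane] q) {x : Fin 2 → ℝ} (hx : x ∈ closedHalfPlane)
    (hp : ContinuousWithinAt p closedHalfPlane x) (hq : ContinuousWithinAt q closedHalfPlane x) :
    p x = q x := by
  by_contra hne
  have hev : ∀ᶠ y in nhdsWithin x closedHalfPlane, p y ≠ q y := by
    have := (hp.sub hq).eventually_ne (sub_ne_zero.2 hne)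
    exact this.mono fun y hy => sub_ne_zero.1 hy
  exact volume_restrict_closedHalfPlane_nhdsWithin_pos hx hev h

/-! ### The whitening map: uniqueness, formula and determinant -/

section Whitening

variable {S T : Matrix (Fin 2) (Fin 2) ℝ}

/-- The explicit map which whitens `S` and preserves the half-plane. -/
noncomputable def halfPlaneWhitening (S : Matrix (Fin 2) (Fin 2) ℝ) : Matrix (Fin 2) (Fin 2) ℝ :=
  (1 / √(S 1 1 * S.det)) • !![S 1 1, -S 0 1; 0, √S.det]

lemma Matrix.PosDef.symm_fin_two (hS : S.PosDef) : S 1 0 = S 0 1 := by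
  simpa using hS.isHermitian.apply 0 1

lemma isPositiveTriangular_halfPlaneWhitening (hS : S.PosDef) :
    IsPositiveTriangular (halfPlaneWhitening S) := by
  have h1 : 0 < S 1 1 := hS.diag_pos
  have hd := hS.det_pos
  constructor <;> simp [halfPlaneWhitening] <;> positivity

lemma IsHalfPlaneWhitening.isPositiveTriangular (hT : IsHalfPlaneWhitening S T) :
    IsPositiveTriangular T := by
  have hmem (x : Fin 2 → ℝ) (hx : x ∈ closedHalfPlane) : 0 ≤ (T *ᵥ x) 1 := by
    have : T *ᵥ x ∈ closedHalfPlane := hT.image_eq ▸ Set.mem_image_of_mem _ hx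
    exact this
  -- Both `±e₁` lie in the half-plane, which forces `T 1 0 = 0`; `e₂` gives `0 ≤ T 1 1`, and the
  -- determinant makes it strict.
  have e1 := hmem ![1, 0] (by simp [closedHalfPlane])
  have e2 := hmem ![-1, 0] (by simp [closedHalfPlane])
  have e3 := hmem ![0, 1] (by simp [closedHalfPlane])
  simp [mulVec, dotProduct, Fin.sum_univ_two] at e1 e2 e3
  have h10 : T 1 0 = 0 := le_antisymm e2 e1
  have hdet := hT.orientation
  rw [det_fin_two, h10, mul_zero, sub_zero] at hdet
  have h11 : 0 < T 1 1 := lt_of_le_of_ne e3 fun h => by simp [← h] at hdet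
  exact ⟨h10, pos_of_mul_pos_left hdet h11.le, h11⟩

lemma IsHalfPlaneWhitening.eq_halfPlaneWhitening (hS : S.PosDef) (hT : IsHalfPlaneWhitening S T) :
    T = halfPlaneWhitening S := by
  have hT' := hT.isPositiveTriangular
  have h1 : 0 < S 1 1 := hS.diag_pos
  have hd := hS.det_pos
  have ha := hT'.left_pos
  have hb := hT'.right_pos
  have hdet := det_fin_two S
  have hw (i j : Fin 2) := congrFun (congrFun hT.whitens i) j
  have w00 := hw 0 0
  have w10 := hw 1 0
  have w11 := hw 1 1
  simp [Matrix.mul_apply, Fin.sum_univ_two, hT'.lower, hS.symm_fin_two] at w00 w10 w11 hdet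
  have k11 : T 1 1 = 1 / √(S 1 1) := by
    rw [eq_div_iff (by positivity), ← sq_eq_sq₀ (by positivity) zero_le_one, mul_pow,
      Real.sq_sqrt h1.le]
    linarith
  have k01 : T 0 1 * S 1 1 = -(T 0 0 * S 0 1) := by
    have : T 1 1 * (T 0 1 * S 1 1 + T 0 0 * S 0 1) = 0 := by linarith
    rcases mul_eq_zero.1 this with h | h <;> linarith
  have k00 : T 0 0 = S 1 1 / √(S 1 1 * S.det) := by
    rw [eq_div_iff (by positivity), ← sq_eq_sq₀ (by positivity) h1.le, mul_pow,
      Real.sq_sqrt (by positivity)]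
    -- Complete the square in `S 1 1` times the equation `w00`; the square vanishes by `k01`.
    have : T 0 0 ^ 2 * S.det = S 1 1 := by
      rw [hdet]
      linear_combination (S 1 1) * w00 - (T 0 1 * S 1 1 + T 0 0 * S 0 1) * k01
    linear_combination S 1 1 * this
  have hs : √(S 1 1 * S.det) = √(S 1 1) * √S.det := Real.sqrt_mul h1.le _
  ext i j
  fin_cases i <;> fin_cases j <;> simp only [halfPlaneWhitening] <;> simp
  · rw [k00]; ring
  · have : T 0 1 = -(T 0 0 * S 0 1) / S 1 1 := by rw [eq_div_iff h1.ne', k01]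
    rw [this, k00]
    field_simp
  · exact hT'.lower
  · rw [k11, hs]
    field_simp

lemma isHalfPlaneWhitening_halfPlaneWhitening (hS : S.PosDef) :
    IsHalfPlaneWhitening S (halfPlaneWhitening S) := by
  have hT := isPositiveTriangular_halfPlaneWhitening hS
  refine ⟨hT.det_pos, hT.image_closedHalfPlane, ?_⟩
  have h1 : 0 < S 1 1 := hS.diag_pos
  have hd := hS.det_pos
  have hdet := det_fin_two S
  rw [hS.symm_fin_two] at hdet
  have hr : √(S 1 1 * S.det) ^ 2 = S 1 1 * S.det := Real.sq_sqrt (by positivity)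
  have hr' : √S.det ^ 2 = S.det := Real.sq_sqrt hd.le
  have hinv : (√(S 1 1 * S.det))⁻¹ ^ 2 * (S 1 1 * S.det) = 1 := by
    rw [inv_pow, hr, inv_mul_cancel₀ (by positivity)]
  unfold halfPlaneWhitening
  rw [one_div]
  -- The radicals matter only through their squares, recorded in `hinv` and `hr'`, so the entries
  -- become polynomial identities.
  generalize (√(S 1 1 * S.det))⁻¹ = c at *
  generalize √S.det = d at *
  ext i j
  fin_cases i <;> fin_cases j <;>
    simp [Matrix.mul_apply, vecMul, dotProduct, Fin.sum_univ_two, hS.symm_fin_two]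
  · linear_combination hinv - c ^ 2 * S 1 1 * hdet
  · exact Or.inl (by ring)
  · ring
  · linear_combination hinv + c ^ 2 * S 1 1 * hr'

lemma det_halfPlaneWhitening (hS : S.PosDef) : (halfPlaneWhitening S).det = 1 / √S.det := by
  have h1 : 0 < S 1 1 := hS.diag_pos
  have hd := hS.det_pos
  have hr : √(S 1 1 * S.det) ^ 2 = S 1 1 * S.det := Real.sq_sqrt (by positivity)
  have hr' : √S.det ^ 2 = S.det := Real.sq_sqrt hd.le
  rw [(isPositiveTriangular_halfPlaneWhitening hS).det_eq]
  simp [halfPlaneWhitening]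
  have hr0 : 0 < √(S 1 1 * S.det) := by positivity
  have hd0 : 0 < √S.det := by positivity
  field_simp
  rw [hr, hr']

lemma halfPlaneWhitening_mulVec (hS : S.PosDef) (x : Fin 2 → ℝ) :
    halfPlaneWhitening S *ᵥ x =
      ![(S 1 1 * x 0 - S 0 1 * x 1) / √(S 1 1 * S.det), x 1 / √(S 1 1)] := by
  have h1 : 0 < S 1 1 := hS.diag_pos
  have hd := hS.det_pos
  have hs : √(S 1 1 * S.det) = √(S 1 1) * √S.det := Real.sqrt_mul h1.le _
  have hd0 : 0 < √S.det := by positivity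
  have h10 : 0 < √(S 1 1) := by positivity
  ext i
  fin_cases i
  · simp [halfPlaneWhitening, mulVec, dotProduct, Fin.sum_univ_two]
    ring
  · simp [halfPlaneWhitening, mulVec, dotProduct, Fin.sum_univ_two, hs]
    field_simp

lemma sqrt_smul_halfPlaneWhitening_mulVec (hS : S.PosDef) (r : ℝ) :
    √(S 1 1) • halfPlaneWhitening S *ᵥ ![r, 1] = ![(S 1 1 * r - S 0 1) / √S.det, 1] := by
  have h1 : 0 < S 1 1 := hS.diag_pos
  have hd := hS.det_pos
  have hs : √(S 1 1 * S.det) = √(S 1 1) * √S.det := Real.sqrt_mul h1.le _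
  have hd0 : 0 < √S.det := by positivity
  have h10 : 0 < √(S 1 1) := by positivity
  rw [halfPlaneWhitening_mulVec hS, hs]
  ext i
  fin_cases i
  · simp
    field_simp
  · simp [h10.ne']

end Whitening

/-! ### The proposition -/

theorem proposition1p3 (S : Matrix (Fin 2) (Fin 2) ℝ) (hS : S.PosDef) :
    (∃! T : Matrix (Fin 2) (Fin 2) ℝ, IsHalfPlaneWhitening S T) ∧
    ∀ T : Matrix (Fin 2) (Fin 2) ℝ, IsHalfPlaneWhitening S T →
      -- the explicit form of the whitening map
      T = (1 / √(S 1 1 * S.det)) • !![S 1 1, -S 0 1; 0, √S.det] ∧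
      ∀ (μ : Fin 2 → ℝ) (rp rm : ℝ),
        -- the image of a reflected Brownian motion
        (∀ {Ω : Type*} [MeasurableSpace Ω] (P : Measure Ω) [IsProbabilityMeasure P]
          (Z : ℝ≥0 → Ω → Fin 2 → ℝ), IsRBM P S μ ![rp, 1] ![rm, 1] Z →
            IsRBM P 1 (T *ᵥ μ) (T *ᵥ ![rp, 1]) (T *ᵥ ![rm, 1]) (fun t ω => T *ᵥ Z t ω)) ∧
        -- the new reflection vectors may be rescaled so as to have second coordinate one
        (∀ {Ω : Type*} [MeasurableSpace Ω] (P : Measure Ω) [IsProbabilityMeasure P]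
          (Z : ℝ≥0 → Ω → Fin 2 → ℝ),
            IsRBM P 1 (T *ᵥ μ) (T *ᵥ ![rp, 1]) (T *ᵥ ![rm, 1]) Z ↔
            IsRBM P 1 (T *ᵥ μ) ![(S 1 1 * rp - S 0 1) / √S.det, 1]
              ![(S 1 1 * rm - S 0 1) / √S.det, 1] Z) ∧
        -- the invariant measures of the image are the pushforwards of those of the original
        {ν' | IsInvariantMeasure 1 (T *ᵥ μ) (T *ᵥ ![rp, 1]) (T *ᵥ ![rm, 1]) ν'} =
          (fun ν : Measure (Fin 2 → ℝ) => ν.map (fun x => T *ᵥ x)) ''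
            {ν | IsInvariantMeasure S μ ![rp, 1] ![rm, 1] ν} ∧
        -- in particular, if the original has a unique one, so does the image: its pushforward
        (∀ ν : Measure (Fin 2 → ℝ),
          (∀ ν₁, IsInvariantMeasure S μ ![rp, 1] ![rm, 1] ν₁ ↔ ν₁ = ν) →
          ∀ ν', IsInvariantMeasure 1 (T *ᵥ μ) (T *ᵥ ![rp, 1]) (T *ᵥ ![rm, 1]) ν' ↔
            ν' = ν.map (fun x => T *ᵥ x)) ∧
        -- change of variables for the densities
        (∀ ν : Measure (Fin 2 → ℝ), IsInvariantMeasure S μ ![rp, 1] ![rm, 1] ν →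
          ((∃ p, IsHalfPlaneDensity ν p) ↔
            ∃ p', IsHalfPlaneDensity (ν.map (fun x => T *ᵥ x)) p') ∧
          (∀ p', IsHalfPlaneDensity (ν.map (fun x => T *ᵥ x)) p' →
            IsHalfPlaneDensity ν (fun x => 1 / √S.det *
              p' ![(S 1 1 * x 0 - S 0 1 * x 1) / √(S 1 1 * S.det), x 1 / √(S 1 1)])) ∧
          ∀ p p', IsHalfPlaneDensity ν p → IsHalfPlaneDensity (ν.map (fun x => T *ᵥ x)) p' →
            (∀ᵐ x ∂(volume.restrict closedHalfPlane), p x = 1 / √S.det *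
              p' ![(S 1 1 * x 0 - S 0 1 * x 1) / √(S 1 1 * S.det), x 1 / √(S 1 1)]) ∧
            ∀ x ∈ closedHalfPlane, ContinuousWithinAt p closedHalfPlane x →
              ContinuousWithinAt p' closedHalfPlane (T *ᵥ x) → p x = 1 / √S.det *
                p' ![(S 1 1 * x 0 - S 0 1 * x 1) / √(S 1 1 * S.det), x 1 / √(S 1 1)]) := by
  have hW := isHalfPlaneWhitening_halfPlaneWhitening hS
  refine ⟨⟨_, hW, fun T hT => hT.eq_halfPlaneWhitening hS⟩, fun T hT => ?_⟩
  obtain rfl := hT.eq_halfPlaneWhitening hS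
  refine ⟨rfl, fun μ rp rm => ?_⟩
  have hA := isPositiveTriangular_halfPlaneWhitening hS
  have hdet := det_halfPlaneWhitening hS
  have hmul := halfPlaneWhitening_mulVec hS
  have hscale := sqrt_smul_halfPlaneWhitening_mulVec hS
  -- The explicit matrix is forgotten; only the properties recorded above are used from here on.
  generalize halfPlaneWhitening S = T at *
  have hmT := measurable_matrix_mulVec T
  have hmT' := measurable_matrix_mulVec T⁻¹
  have hset : {ν' | IsInvariantMeasure 1 (T *ᵥ μ) (T *ᵥ ![rp, 1]) (T *ᵥ ![rm, 1]) ν'} =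
      (fun ν : Measure (Fin 2 → ℝ) => ν.map (fun x => T *ᵥ x)) ''
        {ν | IsInvariantMeasure S μ ![rp, 1] ![rm, 1] ν} := by
    ext ν'
    constructor
    · intro hν'
      refine ⟨ν'.map fun x => T⁻¹ *ᵥ x, ?_, ?_⟩
      · have := IsInvariantMeasure.map_mulVec hA.inv PosDef.one hS
          (mul_congr_inv hA.isUnit_det hW.whitens) hν'
        simpa only [hA.inv_mulVec_mulVec, Set.mem_ofPred_eq] using this
      · simp only [Measure.map_map hmT hmT', Function.comp_def, hA.mulVec_inv_mulVec,
          Measure.map_id']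
    · rintro ⟨ν, hν, rfl⟩
      exact hν.map_mulVec hA hS PosDef.one hW.whitens
  refine ⟨fun P _ Z hZ => hZ.mulVec hA hS PosDef.one hW.whitens, fun P _ Z => ?_, hset, ?_, ?_⟩
  · rw [← hscale, ← hscale]
    exact isRBM_smul_reflection_iff (Real.sqrt_pos.2 hS.diag_pos)
  · intro ν hν ν'
    have : {ν₁ | IsInvariantMeasure S μ ![rp, 1] ![rm, 1] ν₁} = {ν} := Set.ext hν
    rw [this, Set.image_singleton] at hset
    exact Set.ext_iff.1 hset ν'
  · intro ν hν
    have := hν.1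
    simp only [← hmul, ← hdet]
    -- Exhibits `ν` as the image of its pushforward under `T⁻¹`, so that
    -- `IsHalfPlaneDensity.comp_mulVec` also carries densities forward.
    have hback : (ν.map fun x => T *ᵥ x).map (fun x => T⁻¹ *ᵥ x) = ν := by
      simp only [Measure.map_map hmT' hmT, Function.comp_def, hA.inv_mulVec_mulVec,
        Measure.map_id']
    refine ⟨⟨fun ⟨p, hp⟩ => ⟨_, IsHalfPlaneDensity.comp_mulVec hA.inv (hback.symm ▸ hp)⟩,
      fun ⟨p', hp'⟩ => ⟨_, hp'.comp_mulVec hA⟩⟩, fun p' hp' => hp'.comp_mulVec hA,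
      fun p p' hp hp' => ?_⟩
    have hae := hp.ae_eq (hp'.comp_mulVec hA)
    refine ⟨hae, fun x hx hcp hcp' => eq_of_ae_eq_of_continuousWithinAt hae hx hcp ?_⟩
    refine continuousWithinAt_const.mul (hcp'.comp (f := fun y => T *ᵥ y) ?_
      fun y hy => (hA.mulVec_mem_closedHalfPlane y).2 hy)
    exact (Continuous.matrix_mulVec continuous_const continuous_id).continuousWithinAt
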